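/- Let $k\ge 2$ be a fixed integer. For an integer $n\ge 1$ and a probability distribution $p=(p_1,\dots,p_n)$ on $n$ bins (that is, $p_i\ge 0$ and $\sum_{i=1}^n p_i=1$), balls are thrown one after another, each independently landing in bin $i$ with probability $p_i$. Let $T_k$ be the number of throws until some bin contains $k$ balls, and let $\|p\|_k=\big(\sum_{i=1}^n p_i^k\big)^{1/k}$. Put $$c_k:=\int_0^\infty e^{-t^k/k!}\,dt .$$ This integral converges, and $c_k=(k!)^{1/k}\,\Gamma\!\left(1+\tfrac1k\right)$. Moreover: (1) $\|p\|_k\,\mathbb E[T_k]\ge c_k$ for all $n\ge1$ and all $p$, and $c_k$ is the best possible lower bound: if $N$ is an integer and $b$ is such that $\|p\|_k\,\mathbb E[T_k]\ge b$ for all $n\ge N$ and all $p$ on $n$ bins with every $p_i>0$, then $b\le c_k$. (2) $\|p\|_k\,\mathbb E[T_k]\le k$ for all $n\ge1$ and all $p$ (in particular $\mathbb E[T_k]<\infty$), and $k$ is the best possible upper bound: if $N$ is an integer and $b$ is such that $\|p\|_k\,\mathbb E[T_k]\le b$ for all $n\ge N$ and all $p$ on $n$ bins with every $p_i>0$, then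 $b\ge k$. In particular (take $N=1$), $c_k$ and $k$ are the infimum and the supremum of $\|p\|_k\,\mathbb E[T_k]$ over all $n\ge1$ and all $p$. -/

import Mathlib

open MeasureTheory
open scoped ENNReal Nat

namespace BallsBins

/-- `load x m i` is the number of balls in bin `i` after the first `m` throws, where `x j` is the
bin that receives the ball of throw number `j + 1`. -/
def load {n : ℕ} (x : ℕ → Fin n) (m : ℕ) (i : Fin n) : ℕ :=
  ((Finset.range m).filter (fun j => x j = i)).card

/-- The maximum load over all bins after the first `m` throws. -/
def maxLoad {n : ℕ} (x : ℕ → Fin n) (m : ℕ) : ℕ :=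
  Finset.univ.sup (load x m)

/-- The number of throws until the maximum load is `k` (`⊤` if this never happens). -/
noncomputable def waitingTime {n : ℕ} (k : ℕ) (x : ℕ → Fin n) : ℕ∞ :=
  ⨅ (m : ℕ) (_ : k ≤ maxLoad x m), (m : ℕ∞)

/-- The law of an infinite sequence of independent throws, each with distribution `p`. -/
noncomputable def throwsLaw {n : ℕ} (p : PMF (Fin n)) : Measure (ℕ → Fin n) :=
  Measure.infinitePi (fun _ : ℕ => p.toMeasure)

/-- The expected waiting time `E[T_k]`, as an extended nonnegative real number. -/
noncomputable def expectedWait {n : ℕ} (k : ℕ) (p : PMF (Fin n)) : ℝ≥0∞ :=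
  ∫⁻ x, (waitingTime k x : ℝ≥0∞) ∂(throwsLaw p)

/-- The norm `‖p‖_k = (∑ i, p_i ^ k) ^ (1 / k)`. -/
noncomputable def kNorm {n : ℕ} (k : ℕ) (p : PMF (Fin n)) : ℝ≥0∞ :=
  (∑ i, p i ^ k) ^ (1 / (k : ℝ))

/-- The constant `c_k = ∫_0^∞ exp (- t ^ k / k!) dt`. -/
noncomputable def lowerConst (k : ℕ) : ℝ :=
  ∫ t in Set.Ioi (0 : ℝ), Real.exp (-(t ^ k / (k ! : ℝ)))

end BallsBins

namespace BallsBins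

open ProbabilityTheory

/-! ### Loads and the waiting time as a sum of indicators -/

section Load

variable {n : ℕ}

/-! Summing P(T_k > m) over m, with multinomial loads, gives E[T_k] as the sum of (∑ a_i)! ∏
p_i^{a_i}/a_i! over vectors a with all entries below k. Since r! = ∫ e^{-t} t^r dt, this equals ∫ ∏
F(p_i t) dt, where F(x) = e^{-x} ∑_{j<k} x^j/j! is `poissonBelow` (`expectedWait_eq_integral`).
Rescaling t turns ‖p‖_k E[T_k] into ∫ ∏ F(q_i t) dt with ∑ q_i^k = 1.

Write F = e^{-R}, with R the `poissonRate`. Both bounds are pointwise in t. From R(x) ≤ x^k/k! the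
product is at least e^{-t^k/k!}, whose integral is c_k. Since R(x)/x^k decreases, q^k R(x) ≤ R(qx)
for 0 ≤ q ≤ 1; summing over the q_i bounds the product by F(t), whose integral is k.

Uniform distributions approach c_k by dominated convergence, with majorant F. Nearly concentrated
ones approach k, because T_k ≥ k always and ‖p‖_k is at least the largest mass. -/

lemma load_succ (x : ℕ → Fin n) (m : ℕ) :
    load x (m + 1) = load x m + Pi.single (x m) 1 := by
  funext i
  simp only [load, Finset.range_add_one, Finset.filter_insert, Pi.add_apply, Pi.single_apply]
  by_cases h : x m = i
  · simp [h]
  · simp [h, Ne.symm h]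

lemma sum_load (x : ℕ → Fin n) (m : ℕ) : ∑ i, load x m i = m := by
  induction m with
  | zero => simp [load]
  | succ m ih => simp [load_succ, Finset.sum_add_distrib, ih, Pi.single_apply]

lemma maxLoad_mono (x : ℕ → Fin n) : Monotone (maxLoad x) := fun _ _ h =>
  Finset.sup_mono_fun fun _ _ => Finset.card_le_card
    (Finset.filter_subset_filter _ (Finset.range_mono h))

lemma maxLoad_le (x : ℕ → Fin n) (m : ℕ) : maxLoad x m ≤ m :=
  Finset.sup_le fun i _ => (Finset.card_filter_le _ _).trans (by simp)

lemma le_waitingTime (k : ℕ) (x : ℕ → Fin n) : (k : ℕ∞) ≤ waitingTime k x :=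
  le_iInf₂ fun m hm => by exact_mod_cast hm.trans (maxLoad_le x m)

/-- The first time at which a persistent event holds counts the times at which it fails. -/
lemma iInf_toENNReal_eq_tsum (P : ℕ → Prop) [DecidablePred P]
    (hP : ∀ m m', m ≤ m' → P m → P m') :
    (((⨅ (m : ℕ) (_ : P m), (m : ℕ∞)) : ℕ∞) : ℝ≥0∞) = ∑' m, if P m then 0 else 1 := by
  by_cases h : ∃ m, P m
  · have h1 : (⨅ (m : ℕ) (_ : P m), (m : ℕ∞)) = (Nat.find h : ℕ) := by
      refine le_antisymm (iInf₂_le _ (Nat.find_spec h)) (le_iInf₂ fun m hm => ?_)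
      exact_mod_cast Nat.find_min' h hm
    rw [h1, tsum_eq_sum (s := Finset.range (Nat.find h))]
    · rw [Finset.sum_congr rfl (g := fun _ => 1)]
      · simp
      · intro m hm
        rw [if_neg (Nat.find_min h (Finset.mem_range.1 hm))]
    · intro m hm
      rw [if_pos (hP _ _ (by simpa using hm) (Nat.find_spec h))]
  · push Not at h
    simp [h]

lemma waitingTime_eq_tsum {k : ℕ} (hk : 0 < k) (x : ℕ → Fin n) :
    (waitingTime k x : ℝ≥0∞) =
      ∑' m, ∑ a ∈ Fintype.piFinset fun _ : Fin n => Finset.range k,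
        if load x m = a then 1 else 0 := by
  rw [waitingTime, iInf_toENNReal_eq_tsum _ fun m m' h hm => hm.trans (maxLoad_mono x h)]
  refine tsum_congr fun m => ?_
  rw [Finset.sum_ite_eq]
  have : load x m ∈ (Fintype.piFinset fun _ : Fin n => Finset.range k) ↔ ¬ k ≤ maxLoad x m := by
    rw [not_le, maxLoad, Finset.sup_lt_iff (by simpa using hk)]
    simp [Fintype.mem_piFinset]
  simp only [this, ite_not]

lemma measurable_load (m : ℕ) : Measurable fun x : ℕ → Fin n => load x m := by
  induction m with
  | zero =>
    have : (fun x : ℕ → Fin n => load x 0) = fun _ => 0 := rfl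
    rw [this]
    exact measurable_const
  | succ m ih =>
    simp only [load_succ]
    exact ih.add ((measurable_of_finite fun j : Fin n => (Pi.single j 1 : Fin n → ℕ)).comp
      (measurable_pi_apply m))

lemma load_congr {x y : ℕ → Fin n} {m : ℕ} (h : ∀ j < m, x j = y j) : load x m = load y m := by
  funext i
  unfold load
  congr 1
  exact Finset.filter_congr fun j hj => by rw [h j (Finset.mem_range.1 hj)]

end Load

/-! ### Multinomial law of the loads -/

section Law

variable {n : ℕ} (p : PMF (Fin n))

instance : IsProbabilityMeasure (throwsLaw p) := by
  unfold throwsLaw; infer_instance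

/-- A throw is independent of the loads produced by the earlier throws. -/
lemma throwsLaw_load_inter (m : ℕ) (a : Fin n → ℕ) (i : Fin n) :
    throwsLaw p ({x | load x m = a} ∩ {x | x m = i}) = throwsLaw p {x | load x m = a} * p i := by
  have hn : Nonempty (Fin n) := ⟨i⟩
  have hI : iIndepFun (fun (j : ℕ) (x : ℕ → Fin n) => x j) (throwsLaw p) :=
    iIndepFun_infinitePi (P := fun _ : ℕ => p.toMeasure) (X := fun _ x => x) (by fun_prop)
  have hJ := hI.indepFun_finset (Finset.range m) {m} (by simp) (by fun_prop)
  -- Pads the first m throws with an arbitrary bin, which exhibits the load as a function of those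
  -- throws only; `load_congr` makes the padding harmless.
  let ext (y : Finset.range m → Fin n) (j : ℕ) : Fin n :=
    if h : j ∈ Finset.range m then y ⟨j, h⟩ else i
  have hK : IndepFun ((fun y : Finset.range m → Fin n => load (ext y) m) ∘
      fun (x : ℕ → Fin n) (j : Finset.range m) => x j)
      ((fun z : ({m} : Finset ℕ) → Fin n => z ⟨m, Finset.mem_singleton_self m⟩) ∘
      fun (x : ℕ → Fin n) (j : ({m} : Finset ℕ)) => x j) (throwsLaw p) :=
    hJ.comp (measurable_of_finite _) (by fun_prop)
  have h := hK.measure_inter_preimage_eq_mul {a} {i} (MeasurableSet.singleton a)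
    (MeasurableSet.singleton i)
  have h1 : (fun y : Finset.range m → Fin n => load (ext y) m) ∘
      (fun (x : ℕ → Fin n) (j : Finset.range m) => x j) = fun x => load x m := by
    funext x
    exact load_congr fun j hj => by simp [ext, hj]
  rw [h1] at h
  have h2 : throwsLaw p {x | x m = i} = p i := by
    have := Measure.infinitePi_map_eval (fun _ : ℕ => p.toMeasure) m
    rw [← p.toMeasure_apply_singleton i (MeasurableSet.singleton i), ← this,
      Measure.map_apply (measurable_pi_apply m) (MeasurableSet.singleton i)]
    rfl
  rw [← h2]
  exact h

/-- Decomposition by the bin i of the last throw. The guard `0 < a i` is needed because subtraction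
of naturals truncates. -/
lemma throwsLaw_load_succ (m : ℕ) (a : Fin n → ℕ) :
    throwsLaw p {x | load x (m + 1) = a} =
      ∑ i, if 0 < a i then throwsLaw p {x | load x m = a - Pi.single i 1} * p i else 0 := by
  have hset : {x : ℕ → Fin n | load x (m + 1) = a} = ⋃ i ∈ (Finset.univ : Finset (Fin n)),
      if 0 < a i then {x | load x m = a - Pi.single i 1} ∩ {x | x m = i} else ∅ := by
    ext x
    simp only [Set.mem_ite_empty_right, Set.mem_iUnion, Set.mem_ofPred_eq, Finset.mem_univ,
      Set.mem_inter_iff, exists_prop, true_and, load_succ]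
    constructor
    · rintro rfl
      exact ⟨x m, by simp, by simp, rfl⟩
    · rintro ⟨i, hi, h, rfl⟩
      rw [h]
      refine tsub_add_cancel_of_le fun j => ?_
      by_cases hj : j = x m
      · subst hj; simpa using Nat.succ_le_of_lt hi
      · simp [hj]
  rw [hset, measure_biUnion_finset]
  · refine Finset.sum_congr rfl fun i _ => ?_
    split_ifs with h
    · exact throwsLaw_load_inter p m _ i
    · simp
  · intro i _ j _ hij
    refine Set.disjoint_left.2 fun x hx hx' => hij ?_
    simp only [Set.mem_ite_empty_right, Set.mem_inter_iff, Set.mem_ofPred_eq] at hx hx'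
    rw [← hx.2.2, hx'.2.2]
  · intro i _
    split_ifs
    · exact (measurable_load m (MeasurableSet.singleton _)).inter
        (measurableSet_eq_fun (measurable_pi_apply m) measurable_const)
    · exact MeasurableSet.empty

/-- The loads are multinomially distributed. -/
lemma throwsLaw_load (m : ℕ) (a : Fin n → ℕ) (ha : ∑ i, a i = m) :
    (∏ i, ((a i) ! : ℝ≥0∞)) * throwsLaw p {x | load x m = a} = (m ! : ℝ≥0∞) * ∏ i, p i ^ a i := by
  induction m generalizing a with
  | zero =>
    have h0 : a = 0 := by
      funext i
      exact (Finset.sum_eq_zero_iff.1 ha) i (Finset.mem_univ i)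
    subst h0
    have : {x : ℕ → Fin n | load x 0 = 0} = Set.univ := by
      ext x
      simp only [Set.mem_ofPred_eq, Set.mem_univ, iff_true]
      rfl
    simp [this]
  | succ m ih =>
    rw [throwsLaw_load_succ, Finset.mul_sum]
    -- Bin i contributes the share a_i of a common factor; as ∑ a_i = m + 1, the shares turn m! into
    -- (m + 1)!.
    have key : ∀ i ∈ Finset.univ, (∏ i, ((a i) ! : ℝ≥0∞)) *
        (if 0 < a i then throwsLaw p {x | load x m = a - Pi.single i 1} * p i else 0) =
        a i * ((m ! : ℝ≥0∞) * ∏ i, p i ^ a i) := by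
      intro i _
      split_ifs with hi
      · have hle : Pi.single i 1 ≤ a := by
          intro j
          by_cases hj : j = i
          · subst hj; simpa using Nat.succ_le_of_lt hi
          · simp [hj]
        have hsum : ∑ j, (a - Pi.single i 1 : Fin n → ℕ) j = m := by
          have : ∑ j, ((a - Pi.single i 1 : Fin n → ℕ) j + (Pi.single i 1 : Fin n → ℕ) j) = m + 1 := by
            rw [← ha]
            exact Finset.sum_congr rfl fun j _ => tsub_add_cancel_of_le (hle j)
          simpa [Finset.sum_add_distrib, Pi.single_apply] using this
        have h := ih _ hsum
        have hbi : (a - Pi.single i 1 : Fin n → ℕ) i = a i - 1 := by simp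
        have hbj : ∀ j ≠ i, (a - Pi.single i 1 : Fin n → ℕ) j = a j := fun j hj => by simp [hj]
        generalize (a - Pi.single i 1 : Fin n → ℕ) = b at h hbi hbj ⊢
        have e1 : ∏ j, ((a j) ! : ℝ≥0∞) = a i * ∏ j, ((b j) ! : ℝ≥0∞) := by
          rw [← Finset.mul_prod_erase _ _ (Finset.mem_univ i),
            ← Finset.mul_prod_erase _ (fun j => ((b j) ! : ℝ≥0∞))
              (Finset.mem_univ i), ← mul_assoc]
          congr 1
          · rw [hbi]
            exact_mod_cast (Nat.mul_factorial_pred hi.ne').symm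
          · refine Finset.prod_congr rfl fun j hj => ?_
            rw [hbj j (Finset.ne_of_mem_erase hj)]
        have e2 : ∏ j, p j ^ a j = p i * ∏ j, p j ^ b j := by
          rw [← Finset.mul_prod_erase _ _ (Finset.mem_univ i),
            ← Finset.mul_prod_erase _ (fun j => p j ^ b j)
              (Finset.mem_univ i), ← mul_assoc]
          congr 1
          · rw [hbi]
            exact (mul_pow_sub_one hi.ne' _).symm
          · refine Finset.prod_congr rfl fun j hj => ?_
            rw [hbj j (Finset.ne_of_mem_erase hj)]
        calc _ = a i * ((∏ j, ((b j) ! : ℝ≥0∞)) *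
              throwsLaw p {x | load x m = b}) * p i := by rw [e1]; ring
          _ = _ := by rw [h, e2]; ring
      · simp [Nat.eq_zero_of_not_pos hi]
    rw [Finset.sum_congr rfl key, ← Finset.sum_mul, ← Nat.cast_sum, ha, Nat.factorial_succ]
    push_cast
    ring

/-- The expected waiting time as a finite sum over the load vectors below `k`. -/
lemma expectedWait_eq_sum {k : ℕ} (hk : 0 < k) :
    expectedWait k p = ENNReal.ofReal (∑ a ∈ Fintype.piFinset fun _ : Fin n => Finset.range k,
      ((∑ i, a i) ! : ℝ) * ∏ i, ((p i).toReal ^ a i / (a i) !)) := by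
  have hmeas (m : ℕ) (a : Fin n → ℕ) : MeasurableSet {x : ℕ → Fin n | load x m = a} :=
    measurable_load m (MeasurableSet.singleton a)
  have hind (m : ℕ) (a : Fin n → ℕ) : (fun x : ℕ → Fin n => if load x m = a then (1 : ℝ≥0∞) else 0)
      = {x : ℕ → Fin n | load x m = a}.indicator 1 := by
    funext x; simp [Set.indicator_apply]
  have hm (m : ℕ) (a : Fin n → ℕ) :
      Measurable fun x : ℕ → Fin n => if load x m = a then (1 : ℝ≥0∞) else 0 := by
    rw [hind]; exact measurable_one.indicator (hmeas m a)
  have hint : expectedWait k p = ∑' m, ∑ a ∈ Fintype.piFinset fun _ : Fin n => Finset.range k,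
      throwsLaw p {x | load x m = a} := by
    unfold expectedWait
    simp only [waitingTime_eq_tsum hk]
    rw [lintegral_tsum fun m => (Finset.measurable_fun_sum _ fun a _ => hm m a).aemeasurable]
    refine tsum_congr fun m => ?_
    rw [lintegral_finsetSum _ fun a _ => hm m a]
    refine Finset.sum_congr rfl fun a _ => ?_
    rw [hind, lintegral_indicator_one (hmeas m a)]
  rw [hint, Summable.tsum_finsetSum fun _ _ => ENNReal.summable,
    ENNReal.ofReal_sum_of_nonneg fun a _ => by positivity]
  refine Finset.sum_congr rfl fun a _ => ?_
  -- The loads after m throws sum to m, so a given vector can occur at only one time.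
  rw [tsum_eq_single (∑ i, a i)]
  · have hne : ∏ i, ((a i) ! : ℝ≥0∞) ≠ 0 :=
      Finset.prod_ne_zero_iff.2 fun i _ => by exact_mod_cast (Nat.factorial_pos _).ne'
    have hnt : ∏ i, ((a i) ! : ℝ≥0∞) ≠ ⊤ := by
      rw [← Nat.cast_prod]; exact ENNReal.natCast_ne_top _
    rw [← ENNReal.mul_right_inj hne hnt, throwsLaw_load p _ a rfl]
    have h1 : ∏ i, ((a i) ! : ℝ≥0∞) = ENNReal.ofReal (∏ i, ((a i) ! : ℝ)) := by
      rw [← Nat.cast_prod, ← Nat.cast_prod, ENNReal.ofReal_natCast]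
    have h2 : ∏ i, p i ^ a i = ENNReal.ofReal (∏ i, (p i).toReal ^ a i) := by
      rw [ENNReal.ofReal_prod_of_nonneg fun i _ => by positivity]
      refine Finset.prod_congr rfl fun i _ => ?_
      rw [ENNReal.ofReal_pow ENNReal.toReal_nonneg, ENNReal.ofReal_toReal (p.apply_ne_top i)]
    have h3 : ∏ i, ((a i) ! : ℝ) ≠ 0 :=
      Finset.prod_ne_zero_iff.2 fun i _ => by exact_mod_cast (Nat.factorial_pos _).ne'
    rw [h1, h2, ← ENNReal.ofReal_natCast, ← ENNReal.ofReal_mul (by positivity),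
      ← ENNReal.ofReal_mul (by positivity), Finset.prod_div_distrib]
    congr 1
    field_simp
  · intro m hm'
    have : {x : ℕ → Fin n | load x m = a} = ∅ := by
      ext x
      simp only [Set.mem_ofPred_eq, Set.mem_empty_iff_false, iff_false]
      rintro rfl
      exact hm' (sum_load x m).symm
    rw [this, measure_empty]

end Law

open Filter Topology

/-! ### Poisson tails and their logarithmic rate -/

section Tail

/-- The exponential series truncated before degree `k`. -/
noncomputable def truncExp (k : ℕ) (x : ℝ) : ℝ := ∑ j ∈ Finset.range k, x ^ j / (j ! : ℝ)

/-- The probability that a Poisson variable of mean `x` is less than `k`. -/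
noncomputable def poissonBelow (k : ℕ) (x : ℝ) : ℝ := Real.exp (-x) * truncExp k x

/-- Minus the logarithm of `poissonBelow`. -/
noncomputable def poissonRate (k : ℕ) (x : ℝ) : ℝ := x - Real.log (truncExp k x)

lemma truncExp_succ (k : ℕ) (x : ℝ) : truncExp (k + 1) x = truncExp k x + x ^ k / (k ! : ℝ) :=
  Finset.sum_range_succ _ _

lemma one_le_truncExp (k : ℕ) {x : ℝ} (hx : 0 ≤ x) : 1 ≤ truncExp (k + 1) x := by
  rw [truncExp, Finset.sum_range_succ']
  have : 0 ≤ ∑ j ∈ Finset.range k, x ^ (j + 1) / ((j + 1) ! : ℝ) :=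
    Finset.sum_nonneg fun j _ => by positivity
  simpa using this

lemma truncExp_zero_right (k : ℕ) : truncExp (k + 1) 0 = 1 := by
  simp [truncExp, Finset.sum_range_succ']

lemma truncExp_mono (k : ℕ) {x y : ℝ} (hx : 0 ≤ x) (hxy : x ≤ y) :
    truncExp k x ≤ truncExp k y :=
  Finset.sum_le_sum fun j _ => by gcongr

lemma continuous_truncExp (k : ℕ) : Continuous (truncExp k) := by
  unfold truncExp; fun_prop

lemma continuous_poissonBelow (k : ℕ) : Continuous (poissonBelow k) :=
  (by fun_prop : Continuous fun x : ℝ => Real.exp (-x)).mul (continuous_truncExp k)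

lemma hasDerivAt_pow_div_factorial (k : ℕ) (x : ℝ) :
    HasDerivAt (fun y : ℝ => y ^ (k + 1) / ((k + 1) ! : ℝ)) (x ^ k / (k ! : ℝ)) x := by
  refine ((hasDerivAt_pow (k + 1) x).div_const ((k + 1) ! : ℝ)).congr_deriv ?_
  rw [Nat.factorial_succ]
  push_cast
  field_simp

lemma hasDerivAt_truncExp (k : ℕ) (x : ℝ) : HasDerivAt (truncExp (k + 1)) (truncExp k x) x := by
  induction k with
  | zero =>
    have : truncExp 1 = fun _ => 1 := by funext y; simp [truncExp]
    rw [this]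
    simpa [truncExp] using hasDerivAt_const x (1 : ℝ)
  | succ k ih =>
    have : truncExp (k + 1 + 1) = fun y => truncExp (k + 1) y + y ^ (k + 1) / ((k + 1) ! : ℝ) :=
      funext fun y => truncExp_succ _ y
    rw [this, truncExp_succ k x]
    exact ih.add (hasDerivAt_pow_div_factorial k x)

/-- Differentiating the truncated exponential drops its top term, so 1 minus the logarithmic
derivative leaves just that term over the whole sum. -/
lemma hasDerivAt_poissonRate (k : ℕ) {x : ℝ} (hx : 0 ≤ x) :
    HasDerivAt (poissonRate (k + 1)) (x ^ k / (k ! : ℝ) / truncExp (k + 1) x) x := by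
  have h1 := one_le_truncExp k hx
  have hne : truncExp (k + 1) x ≠ 0 := by positivity
  refine ((hasDerivAt_id x).sub ((hasDerivAt_truncExp k x).log hne)).congr_deriv ?_
  rw [eq_comm, eq_sub_iff_add_eq, ← add_div, add_comm, ← truncExp_succ, div_self hne]

lemma poissonRate_zero (k : ℕ) : poissonRate (k + 1) 0 = 0 := by
  simp [poissonRate, truncExp_zero_right]

lemma poissonBelow_eq_exp (k : ℕ) {x : ℝ} (hx : 0 ≤ x) :
    poissonBelow (k + 1) x = Real.exp (-poissonRate (k + 1) x) := by
  have h1 := one_le_truncExp k hx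
  rw [poissonRate, poissonBelow, neg_sub, sub_eq_add_neg, Real.exp_add,
    Real.exp_log (by positivity), mul_comm]

/-- The denominator in the derivative of the rate is at least 1, and both sides vanish at 0. -/
lemma poissonRate_le (k : ℕ) {x : ℝ} (hx : 0 ≤ x) :
    poissonRate (k + 1) x ≤ x ^ (k + 1) / ((k + 1) ! : ℝ) := by
  have hd : ∀ y, 0 ≤ y → HasDerivAt
      (fun y => y ^ (k + 1) / ((k + 1) ! : ℝ) - poissonRate (k + 1) y)
      (y ^ k / (k ! : ℝ) - y ^ k / (k ! : ℝ) / truncExp (k + 1) y) y := fun y hy =>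
    (hasDerivAt_pow_div_factorial k y).sub (hasDerivAt_poissonRate k hy)
  have hm : MonotoneOn (fun y => y ^ (k + 1) / ((k + 1) ! : ℝ) - poissonRate (k + 1) y)
      (Set.Ici 0) := by
    refine monotoneOn_of_deriv_nonneg (convex_Ici 0)
      (fun y hy => (hd y hy).continuousAt.continuousWithinAt)
      (fun y hy => (hd y (interior_subset hy)).differentiableAt.differentiableWithinAt)
      fun y hy => ?_
    have hy0 : 0 ≤ y := interior_subset hy
    rw [(hd y hy0).deriv, sub_nonneg]
    exact div_le_self (by positivity) (one_le_truncExp k hy0)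
  have := hm (Set.self_mem_Ici) (Set.mem_Ici.2 hx) hx
  simpa [poissonRate_zero] using this

/-- On [0, x] the denominator in the derivative is at most its value C at the endpoint; freeze it
there and compare derivatives. -/
lemma le_poissonRate (k : ℕ) {x : ℝ} (hx : 0 ≤ x) :
    x ^ (k + 1) / ((k + 1) ! : ℝ) / truncExp (k + 1) x ≤ poissonRate (k + 1) x := by
  set C := truncExp (k + 1) x with hC
  have hd : ∀ y, 0 ≤ y → HasDerivAt
      (fun y => poissonRate (k + 1) y - y ^ (k + 1) / ((k + 1) ! : ℝ) / C)
      (y ^ k / (k ! : ℝ) / truncExp (k + 1) y - y ^ k / (k ! : ℝ) / C) y := fun y hy =>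
    (hasDerivAt_poissonRate k hy).sub ((hasDerivAt_pow_div_factorial k y).div_const C)
  have hm : MonotoneOn (fun y => poissonRate (k + 1) y - y ^ (k + 1) / ((k + 1) ! : ℝ) / C)
      (Set.Icc 0 x) := by
    refine monotoneOn_of_deriv_nonneg (convex_Icc 0 x)
      (fun y hy => (hd y hy.1).continuousAt.continuousWithinAt)
      (fun y hy => (hd y (interior_subset hy).1).differentiableAt.differentiableWithinAt)
      fun y hy => ?_
    have hy0 : y ∈ Set.Icc 0 x := interior_subset hy
    have h0 := hy0.1
    rw [(hd y h0).deriv, sub_nonneg]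
    have h1 := one_le_truncExp k h0
    have h2 := truncExp_mono (k + 1) h0 hy0.2
    gcongr
  have := hm (Set.left_mem_Icc.2 hx) (Set.right_mem_Icc.2 hx) hx
  simpa [poissonRate_zero] using this

/-- The numerator in the quotient rule is nonpositive precisely by `le_poissonRate`, multiplied by
(k + 1) y^k. -/
lemma antitoneOn_poissonRate_div_pow (k : ℕ) :
    AntitoneOn (fun x => poissonRate (k + 1) x / x ^ (k + 1)) (Set.Ioi 0) := by
  have hd : ∀ y, 0 < y → HasDerivAt (fun x => poissonRate (k + 1) x / x ^ (k + 1))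
      ((y ^ k / (k ! : ℝ) / truncExp (k + 1) y * y ^ (k + 1) -
        poissonRate (k + 1) y * ((k + 1 : ℕ) * y ^ k)) / (y ^ (k + 1)) ^ 2) y := fun y hy =>
    (hasDerivAt_poissonRate k hy.le).fun_div (hasDerivAt_pow (k + 1) y) (by positivity)
  refine antitoneOn_of_deriv_nonpos (convex_Ioi 0)
    (fun y hy => (hd y hy).continuousAt.continuousWithinAt)
    (fun y hy => (hd y (interior_subset hy)).differentiableAt.differentiableWithinAt)
    fun y hy => ?_
  have hy0 : 0 < y := interior_subset hy
  rw [(hd y hy0).deriv]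
  refine div_nonpos_of_nonpos_of_nonneg (sub_nonpos.2 ?_) (by positivity)
  have h1 := one_le_truncExp k hy0.le
  have h2 := mul_le_mul_of_nonneg_right (le_poissonRate k hy0.le)
    (by positivity : 0 ≤ ((k + 1 : ℕ) : ℝ) * y ^ k)
  refine le_trans (le_of_eq ?_) h2
  rw [Nat.factorial_succ]
  push_cast
  field_simp

lemma pow_mul_poissonRate_le (k : ℕ) {q x : ℝ} (hq : 0 ≤ q) (hq1 : q ≤ 1) (hx : 0 ≤ x) :
    q ^ (k + 1) * poissonRate (k + 1) x ≤ poissonRate (k + 1) (q * x) := by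
  rcases hq.eq_or_lt with rfl | hq
  · simp [poissonRate_zero]
  rcases hx.eq_or_lt with rfl | hx
  · simp [poissonRate_zero]
  have h := antitoneOn_poissonRate_div_pow k (Set.mem_Ioi.2 (mul_pos hq hx)) (Set.mem_Ioi.2 hx)
    (mul_le_of_le_one_left hx.le hq1)
  simp only [mul_pow] at h
  rw [div_le_div_iff₀ (by positivity) (by positivity)] at h
  have hxp : 0 < x ^ (k + 1) := by positivity
  nlinarith

lemma prod_poissonBelow_eq_exp {ι : Type*} [Fintype ι] (k : ℕ) {q : ι → ℝ} (hq : ∀ i, 0 ≤ q i)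
    {x : ℝ} (hx : 0 ≤ x) :
    ∏ i, poissonBelow (k + 1) (q i * x) = Real.exp (-∑ i, poissonRate (k + 1) (q i * x)) := by
  rw [← Finset.sum_neg_distrib, Real.exp_sum]
  exact Finset.prod_congr rfl fun i _ => poissonBelow_eq_exp k (mul_nonneg (hq i) hx)

lemma prod_poissonBelow_le {ι : Type*} [Fintype ι] (k : ℕ) {q : ι → ℝ} (hq : ∀ i, 0 ≤ q i)
    (hs : ∑ i, q i ^ (k + 1) = 1) {x : ℝ} (hx : 0 ≤ x) :
    ∏ i, poissonBelow (k + 1) (q i * x) ≤ poissonBelow (k + 1) x := by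
  rw [prod_poissonBelow_eq_exp k hq hx, poissonBelow_eq_exp k hx, Real.exp_le_exp, neg_le_neg_iff]
  calc poissonRate (k + 1) x = ∑ i, q i ^ (k + 1) * poissonRate (k + 1) x := by
        rw [← Finset.sum_mul, hs, one_mul]
    _ ≤ _ := Finset.sum_le_sum fun i _ => by
        refine pow_mul_poissonRate_le k (hq i) ?_ hx
        refine (pow_le_one_iff_of_nonneg (hq i) k.succ_ne_zero).1 ?_
        rw [← hs]
        exact Finset.single_le_sum (f := fun i => q i ^ (k + 1))
          (fun j _ => pow_nonneg (hq j) _) (Finset.mem_univ i)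

lemma exp_le_prod_poissonBelow {ι : Type*} [Fintype ι] (k : ℕ) {q : ι → ℝ} (hq : ∀ i, 0 ≤ q i)
    (hs : ∑ i, q i ^ (k + 1) = 1) {x : ℝ} (hx : 0 ≤ x) :
    Real.exp (-(x ^ (k + 1) / ((k + 1) ! : ℝ))) ≤ ∏ i, poissonBelow (k + 1) (q i * x) := by
  rw [prod_poissonBelow_eq_exp k hq hx, Real.exp_le_exp, neg_le_neg_iff]
  calc _ ≤ ∑ i, (q i * x) ^ (k + 1) / ((k + 1) ! : ℝ) :=
        Finset.sum_le_sum fun i _ => poissonRate_le k (mul_nonneg (hq i) hx)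
    _ = _ := by simp_rw [mul_pow, mul_div_assoc]; rw [← Finset.sum_mul, hs, one_mul]

lemma prod_poissonBelow_nonneg {ι : Type*} [Fintype ι] (k : ℕ) {q : ι → ℝ} (hq : ∀ i, 0 ≤ q i)
    {x : ℝ} (hx : 0 ≤ x) : 0 ≤ ∏ i, poissonBelow (k + 1) (q i * x) := by
  rw [prod_poissonBelow_eq_exp k hq hx]; positivity

end Tail

/-! ### Gamma integrals -/

section Integrals

lemma integrableOn_exp_neg_mul_pow (m : ℕ) :
    IntegrableOn (fun t : ℝ => Real.exp (-t) * t ^ m) (Set.Ioi 0) := by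
  simpa using Real.GammaIntegral_convergent (s := m + 1) (by positivity)

lemma integral_exp_neg_mul_pow (m : ℕ) :
    ∫ t in Set.Ioi (0 : ℝ), Real.exp (-t) * t ^ m = (m ! : ℝ) := by
  rw [← Real.Gamma_nat_eq_factorial, Real.Gamma_eq_integral (by positivity)]
  simp

lemma integrableOn_poissonBelow (k : ℕ) : IntegrableOn (poissonBelow k) (Set.Ioi 0) := by
  have : poissonBelow k = fun t =>
      ∑ j ∈ Finset.range k, (Real.exp (-t) * t ^ j) / (j ! : ℝ) := by
    funext t
    simp [poissonBelow, truncExp, Finset.mul_sum, mul_div_assoc]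
  rw [this]
  exact integrable_finsetSum _ fun j _ => (integrableOn_exp_neg_mul_pow j).div_const _

/-- Each of the k terms e^{-t} t^j/j! integrates to 1. -/
lemma integral_poissonBelow (k : ℕ) : ∫ t in Set.Ioi (0 : ℝ), poissonBelow k t = k := by
  have : poissonBelow k = fun t =>
      ∑ j ∈ Finset.range k, (Real.exp (-t) * t ^ j) / (j ! : ℝ) := by
    funext t
    simp [poissonBelow, truncExp, Finset.mul_sum, mul_div_assoc]
  rw [this, integral_finsetSum _ fun j _ => (integrableOn_exp_neg_mul_pow j).div_const _]
  simp_rw [integral_div, integral_exp_neg_mul_pow]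
  simp [Nat.factorial_ne_zero]

lemma integrableOn_prod_poissonBelow {ι : Type*} [Fintype ι] (k : ℕ) {q : ι → ℝ}
    (hq : ∀ i, 0 ≤ q i) (hs : ∑ i, q i ^ (k + 1) = 1) :
    IntegrableOn (fun x => ∏ i, poissonBelow (k + 1) (q i * x)) (Set.Ioi 0) := by
  refine (integrableOn_poissonBelow (k + 1)).mono' ?_ ?_
  · exact (continuous_finsetProd _ fun i _ => (continuous_poissonBelow (k + 1)).comp
      (continuous_const_mul (q i))).aestronglyMeasurable
  · filter_upwards [self_mem_ae_restrict measurableSet_Ioi] with x hx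
    have hx0 : (0 : ℝ) ≤ x := le_of_lt hx
    rw [Real.norm_of_nonneg (prod_poissonBelow_nonneg k hq hx0)]
    exact prod_poissonBelow_le k hq hs hx0

lemma integrableOn_exp_neg_pow_div {k : ℕ} (hk : 0 < k) :
    IntegrableOn (fun t : ℝ => Real.exp (-(t ^ k / (k ! : ℝ)))) (Set.Ioi 0) := by
  have h := integrableOn_rpow_mul_exp_neg_mul_rpow (p := k) (s := 0) (b := (k ! : ℝ)⁻¹)
    (by norm_num) (by exact_mod_cast hk) (by positivity)
  refine h.congr_fun (fun t _ => ?_) measurableSet_Ioi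
  simp only [Real.rpow_zero, one_mul, Real.rpow_natCast]
  congr 1
  ring

lemma lowerConst_eq {k : ℕ} (hk : 0 < k) :
    lowerConst k = (k ! : ℝ) ^ (1 / (k : ℝ)) * Real.Gamma (1 + 1 / (k : ℝ)) := by
  have h := integral_exp_neg_mul_rpow (p := k) (b := (k ! : ℝ)⁻¹) (by exact_mod_cast hk)
    (by positivity)
  rw [Real.inv_rpow (by positivity), neg_div, Real.rpow_neg (by positivity), inv_inv] at h
  rw [add_comm (1 : ℝ), ← h, lowerConst]
  congr 1
  funext t
  rw [Real.rpow_natCast]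
  congr 1
  ring

end Integrals

/-! ### Poissonization and the two bounds -/

section Product

variable {n : ℕ} (p : PMF (Fin n))

lemma sum_toReal : ∑ i, (p i).toReal = 1 := by
  rw [← ENNReal.toReal_sum fun i _ => p.apply_ne_top i, ← tsum_fintype (L := .unconditional _),
    p.tsum_coe, ENNReal.toReal_one]

/-- The norm `‖p‖_k` as a real number. -/
noncomputable def realNorm (k : ℕ) : ℝ := (∑ i, (p i).toReal ^ k) ^ (1 / (k : ℝ))

lemma kNorm_eq_ofReal (k : ℕ) : kNorm k p = ENNReal.ofReal (realNorm p k) := by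
  rw [kNorm, realNorm, ← ENNReal.ofReal_rpow_of_nonneg (by positivity) (by positivity),
    ENNReal.ofReal_sum_of_nonneg fun i _ => by positivity]
  congr 1
  refine Finset.sum_congr rfl fun i _ => ?_
  rw [ENNReal.ofReal_pow ENNReal.toReal_nonneg, ENNReal.ofReal_toReal (p.apply_ne_top i)]

lemma realNorm_pow {k : ℕ} (hk : 0 < k) : realNorm p k ^ k = ∑ i, (p i).toReal ^ k := by
  rw [realNorm, one_div, Real.rpow_inv_natCast_pow (by positivity) hk.ne']

lemma realNorm_pos (k : ℕ) : 0 < realNorm p k := by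
  have h : ∃ i, 0 < (p i).toReal := by
    by_contra! h
    have := Finset.sum_nonpos fun i (_ : i ∈ Finset.univ) => h i
    rw [sum_toReal p] at this
    linarith
  obtain ⟨i, hi⟩ := h
  exact Real.rpow_pos_of_pos (Finset.sum_pos' (fun j _ => by positivity)
    ⟨i, Finset.mem_univ i, by positivity⟩) _

lemma sum_div_realNorm_pow {k : ℕ} (hk : 0 < k) :
    ∑ i, ((p i).toReal / realNorm p k) ^ k = 1 := by
  simp_rw [div_pow]
  rw [← Finset.sum_div, realNorm_pow p hk]
  exact div_self (by rw [← realNorm_pow p hk]; exact (pow_pos (realNorm_pos p k) k).ne')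

/-- The expected waiting time as an integral, by Poissonization. -/
lemma expectedWait_eq_integral {k : ℕ} (hk : 0 < k) :
    expectedWait k p =
      ENNReal.ofReal (∫ t in Set.Ioi (0 : ℝ), ∏ i, poissonBelow k ((p i).toReal * t)) := by
  rw [expectedWait_eq_sum p hk]
  congr 1
  have h : ∀ t : ℝ, ∏ i, poissonBelow k ((p i).toReal * t) =
      ∑ a ∈ Fintype.piFinset fun _ : Fin n => Finset.range k,
        (Real.exp (-t) * t ^ (∑ i, a i)) * ∏ i, ((p i).toReal ^ a i / (a i) !) := by
    intro t
    simp only [poissonBelow, truncExp]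
    rw [Finset.prod_mul_distrib, ← Real.exp_sum, Finset.sum_neg_distrib, ← Finset.sum_mul,
      sum_toReal, one_mul, Finset.prod_univ_sum, Finset.mul_sum]
    refine Finset.sum_congr rfl fun a _ => ?_
    rw [mul_assoc, ← Finset.prod_pow_eq_pow_sum, ← Finset.prod_mul_distrib]
    congr 1
    exact Finset.prod_congr rfl fun i _ => by rw [mul_pow]; ring
  simp_rw [h]
  rw [integral_finsetSum _ fun a _ => (integrableOn_exp_neg_mul_pow _).mul_const _]
  refine Finset.sum_congr rfl fun a _ => ?_
  rw [integral_mul_const, integral_exp_neg_mul_pow]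

lemma kNorm_mul_expectedWait {k : ℕ} (hk : 0 < k) :
    kNorm k p * expectedWait k p = ENNReal.ofReal
      (∫ t in Set.Ioi (0 : ℝ), ∏ i, poissonBelow k ((p i).toReal / realNorm p k * t)) := by
  have hr := realNorm_pos p k
  rw [kNorm_eq_ofReal, expectedWait_eq_integral p hk, ← ENNReal.ofReal_mul hr.le]
  congr 1
  have h := integral_comp_mul_left_Ioi
    (fun t => ∏ i, poissonBelow k ((p i).toReal * t)) 0 (inv_pos.2 hr)
  rw [mul_zero, inv_inv, smul_eq_mul] at h
  rw [← h]
  simp only [div_eq_mul_inv, mul_assoc]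

lemma lowerConst_le {k : ℕ} (hk : 0 < k) :
    ENNReal.ofReal (lowerConst k) ≤ kNorm k p * expectedWait k p := by
  rw [kNorm_mul_expectedWait p hk]
  obtain ⟨k, rfl⟩ := Nat.exists_eq_add_one.2 hk
  have hq : ∀ i, 0 ≤ (p i).toReal / realNorm p (k + 1) := fun i =>
    div_nonneg ENNReal.toReal_nonneg (realNorm_pos p _).le
  exact ENNReal.ofReal_le_ofReal (setIntegral_mono_on (integrableOn_exp_neg_pow_div hk)
    (integrableOn_prod_poissonBelow k hq (sum_div_realNorm_pow p hk)) measurableSet_Ioi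
    fun t ht => exp_le_prod_poissonBelow k hq (sum_div_realNorm_pow p hk) (le_of_lt ht))

lemma kNorm_mul_expectedWait_le {k : ℕ} (hk : 0 < k) :
    kNorm k p * expectedWait k p ≤ k := by
  rw [kNorm_mul_expectedWait p hk]
  obtain ⟨k, rfl⟩ := Nat.exists_eq_add_one.2 hk
  have hq : ∀ i, 0 ≤ (p i).toReal / realNorm p (k + 1) := fun i =>
    div_nonneg ENNReal.toReal_nonneg (realNorm_pos p _).le
  rw [← ENNReal.ofReal_natCast, ← integral_poissonBelow (k + 1)]
  exact ENNReal.ofReal_le_ofReal (setIntegral_mono_on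
    (integrableOn_prod_poissonBelow k hq (sum_div_realNorm_pow p hk))
    (integrableOn_poissonBelow (k + 1)) measurableSet_Ioi
    fun t ht => prod_poissonBelow_le k hq (sum_div_realNorm_pow p hk) (le_of_lt ht))

end Product

/-! ### Sharpness of the lower bound -/

section Uniform

lemma kNorm_mul_expectedWait_uniform {k : ℕ} (hk : 0 < k) (m : ℕ) :
    kNorm k (PMF.uniformOfFintype (Fin (m + 1))) *
        expectedWait k (PMF.uniformOfFintype (Fin (m + 1))) =
      ENNReal.ofReal (∫ t in Set.Ioi (0 : ℝ),
        poissonBelow k ((1 / ((m : ℝ) + 1)) ^ (1 / (k : ℝ)) * t) ^ (m + 1)) := by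
  have h : ∀ i, (PMF.uniformOfFintype (Fin (m + 1)) i).toReal /
      realNorm (PMF.uniformOfFintype (Fin (m + 1))) k = (1 / ((m : ℝ) + 1)) ^ (1 / (k : ℝ)) := by
    intro i
    have hr := realNorm_pos (PMF.uniformOfFintype (Fin (m + 1))) k
    have hs := sum_div_realNorm_pow (PMF.uniformOfFintype (Fin (m + 1))) hk
    simp only [PMF.uniformOfFintype_apply, Finset.sum_const, Finset.card_univ, Fintype.card_fin,
      nsmul_eq_mul] at hs ⊢
    push_cast at hs ⊢
    -- The m + 1 normalized masses are equal and their k-th powers sum to 1, which determines them.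
    rw [← eq_one_div_of_mul_eq_one_right hs, one_div (k : ℝ),
      Real.pow_rpow_inv_natCast (div_nonneg ENNReal.toReal_nonneg hr.le) hk.ne']
  rw [kNorm_mul_expectedWait _ hk]
  simp only [h, Finset.prod_const, Finset.card_univ, Fintype.card_fin]

lemma tendsto_one_div_rpow {k : ℕ} (hk : 0 < k) :
    Tendsto (fun m : ℕ => (1 / ((m : ℝ) + 1)) ^ (1 / (k : ℝ))) atTop (𝓝 0) := by
  have hk' : (0 : ℝ) < 1 / (k : ℝ) := by positivity
  have := (tendsto_one_div_add_atTop_nhds_zero_nat (𝕜 := ℝ)).rpow_const (Or.inr hk'.le)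
    (p := 1 / (k : ℝ))
  rwa [Real.zero_rpow hk'.ne'] at this

/-- Squeeze between `poissonRate_le` and `le_poissonRate`: they differ by the factor `truncExp (k +
1) (c * t)`, which tends to 1 as the scale c tends to 0. -/
lemma tendsto_poissonBelow_pow (k : ℕ) {t : ℝ} (ht : 0 ≤ t) :
    Tendsto (fun m : ℕ =>
        poissonBelow (k + 1) ((1 / ((m : ℝ) + 1)) ^ (1 / ((k + 1 : ℕ) : ℝ)) * t) ^ (m + 1))
      atTop (𝓝 (Real.exp (-(t ^ (k + 1) / ((k + 1) ! : ℝ))))) := by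
  have hc0 : ∀ m : ℕ, 0 ≤ (1 / ((m : ℝ) + 1)) ^ (1 / ((k + 1 : ℕ) : ℝ)) := fun m => by positivity
  have hc : ∀ m : ℕ, ((m : ℝ) + 1) * ((1 / ((m : ℝ) + 1)) ^ (1 / ((k + 1 : ℕ) : ℝ))) ^ (k + 1)
      = 1 := fun m => by
    rw [one_div ((k + 1 : ℕ) : ℝ), Real.rpow_inv_natCast_pow (by positivity) k.succ_ne_zero]
    field_simp
  have hlim : Tendsto (fun m : ℕ => truncExp (k + 1)
      ((1 / ((m : ℝ) + 1)) ^ (1 / ((k + 1 : ℕ) : ℝ)) * t)) atTop (𝓝 1) := by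
    have h := (tendsto_one_div_rpow k.succ_pos).mul_const t
    rw [zero_mul] at h
    have h' := ((continuous_truncExp (k + 1)).tendsto 0).comp h
    rwa [truncExp_zero_right] at h'
  have hup : Tendsto (fun m : ℕ => Real.exp (-(t ^ (k + 1) / ((k + 1) ! : ℝ) / truncExp (k + 1)
      ((1 / ((m : ℝ) + 1)) ^ (1 / ((k + 1 : ℕ) : ℝ)) * t)))) atTop
      (𝓝 (Real.exp (-(t ^ (k + 1) / ((k + 1) ! : ℝ))))) := by
    refine (Real.continuous_exp.tendsto _).comp (Tendsto.neg ?_)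
    have h := (tendsto_const_nhds (x := t ^ (k + 1) / ((k + 1) ! : ℝ))).div hlim one_ne_zero
    rwa [div_one] at h
  refine tendsto_of_tendsto_of_tendsto_of_le_of_le tendsto_const_nhds hup (fun m => ?_)
    (fun m => ?_)
  all_goals
    have hct := mul_nonneg (hc0 m) ht
    have hcm := hc m
    simp only
    generalize (1 / ((m : ℝ) + 1)) ^ (1 / ((k + 1 : ℕ) : ℝ)) = c at hct hcm ⊢
    rw [poissonBelow_eq_exp k hct, ← Real.exp_nat_mul, Real.exp_le_exp, mul_neg, neg_le_neg_iff]
    push_cast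
    have hm : (0 : ℝ) ≤ (m : ℝ) + 1 := by positivity
    have he : t ^ (k + 1) / ((k + 1) ! : ℝ) =
        ((m : ℝ) + 1) * ((c * t) ^ (k + 1) / ((k + 1) ! : ℝ)) := by
      rw [mul_pow, mul_div_assoc, ← mul_assoc, hcm, one_mul]
    rw [he]
  · exact mul_le_mul_of_nonneg_left (poissonRate_le k hct) hm
  · rw [mul_div_assoc]
    exact mul_le_mul_of_nonneg_left (le_poissonRate k hct) hm

lemma tendsto_kNorm_mul_expectedWait_uniform {k : ℕ} (hk : 0 < k) :
    Tendsto (fun m : ℕ => kNorm k (PMF.uniformOfFintype (Fin (m + 1))) *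
        expectedWait k (PMF.uniformOfFintype (Fin (m + 1)))) atTop
      (𝓝 (ENNReal.ofReal (lowerConst k))) := by
  simp_rw [kNorm_mul_expectedWait_uniform hk]
  refine ENNReal.tendsto_ofReal ?_
  obtain ⟨k, rfl⟩ := Nat.exists_eq_add_one.2 hk
  refine tendsto_integral_of_dominated_convergence (poissonBelow (k + 1)) (fun m => ?_)
    (integrableOn_poissonBelow (k + 1)) (fun m => ?_) ?_
  · exact (((continuous_poissonBelow (k + 1)).comp
      (continuous_const_mul _)).pow (m + 1)).aestronglyMeasurable
  · filter_upwards [self_mem_ae_restrict measurableSet_Ioi] with t ht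
    have ht0 : (0 : ℝ) ≤ t := le_of_lt ht
    have hc0 : 0 ≤ (1 / ((m : ℝ) + 1)) ^ (1 / ((k + 1 : ℕ) : ℝ)) := by positivity
    have hs : ∑ _i : Fin (m + 1), ((1 / ((m : ℝ) + 1)) ^ (1 / ((k + 1 : ℕ) : ℝ))) ^ (k + 1)
        = 1 := by
      rw [one_div ((k + 1 : ℕ) : ℝ), Real.rpow_inv_natCast_pow (by positivity) k.succ_ne_zero]
      simp
      field_simp
    have h0 := prod_poissonBelow_nonneg k (fun _ : Fin (m + 1) => hc0) ht0
    have h1 := prod_poissonBelow_le k (fun _ : Fin (m + 1) => hc0) hs ht0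
    simp only [Finset.prod_const, Finset.card_univ, Fintype.card_fin] at h0 h1
    rwa [Real.norm_of_nonneg h0]
  · filter_upwards [self_mem_ae_restrict measurableSet_Ioi] with t ht
    exact tendsto_poissonBelow_pow k (le_of_lt ht)

end Uniform

/-! ### Sharpness of the upper bound -/

section Concentrated

lemma le_expectedWait {n : ℕ} (k : ℕ) (p : PMF (Fin n)) : (k : ℝ≥0∞) ≤ expectedWait k p := by
  calc (k : ℝ≥0∞) = ∫⁻ _, (k : ℝ≥0∞) ∂(throwsLaw p) := by simp
    _ ≤ _ := lintegral_mono fun x => by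
      have := ENat.toENNReal_le.2 (le_waitingTime k x)
      simpa using this

lemma le_kNorm {n k : ℕ} (hk : 0 < k) (p : PMF (Fin n)) (i : Fin n) : p i ≤ kNorm k p := by
  have hk' : (k : ℝ) ≠ 0 := by positivity
  calc p i = (p i ^ k) ^ (1 / (k : ℝ)) := by
        rw [← ENNReal.rpow_natCast, ← ENNReal.rpow_mul, mul_one_div_cancel hk', ENNReal.rpow_one]
    _ ≤ _ := ENNReal.rpow_le_rpow
        (Finset.single_le_sum (f := fun i => p i ^ k) (fun _ _ => zero_le) (Finset.mem_univ i))
        (by positivity)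

/-- A distribution that charges every bin and gives one bin mass at least `1 - d`. -/
lemma exists_concentrated (N : ℕ) {d : ℝ≥0∞} (hd0 : 0 < d) (hd1 : d < 1) :
    ∃ p : PMF (Fin (N + 1)), (∀ i, 0 < p i) ∧ 1 - d ≤ p 0 := by
  have hN : ((N : ℝ≥0∞) + 1) ≠ 0 := by simp
  have hNt : ((N : ℝ≥0∞) + 1) ≠ ⊤ := by simp
  have hle : N * (d / (N + 1)) ≤ d := by
    calc (N : ℝ≥0∞) * (d / (N + 1)) ≤ (N + 1) * (d / (N + 1)) := by gcongr; simp
      _ = d := ENNReal.mul_div_cancel hN hNt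
  -- Dividing by N + 1 rather than N keeps the quotient meaningful for N = 0; the N small bins still
  -- take at most d in total.
  let w : Fin (N + 1) → ℝ≥0∞ := Fin.cons (1 - N * (d / (N + 1))) fun _ => d / (N + 1)
  have hw : ∑ i, w i = 1 := by
    simp only [w, Fin.sum_univ_succ, Fin.cons_zero, Fin.cons_succ, Finset.sum_const,
      Finset.card_univ, Fintype.card_fin, nsmul_eq_mul]
    exact tsub_add_cancel_of_le (hle.trans hd1.le)
  refine ⟨PMF.ofFintype w hw, fun i => ?_, ?_⟩
  · rw [PMF.ofFintype_apply]
    refine Fin.cases ?_ (fun j => ?_) i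
    · exact tsub_pos_of_lt (hle.trans_lt hd1)
    · exact ENNReal.div_pos hd0.ne' hNt
  · rw [PMF.ofFintype_apply]
    exact tsub_le_tsub_left hle 1

end Concentrated

end BallsBins

theorem mainTheorem7 (k : ℕ) (hk : 2 ≤ k) :
    -- the integral defining `c_k` converges and has the stated closed form
    (IntegrableOn (fun t : ℝ => Real.exp (-(t ^ k / (k ! : ℝ)))) (Set.Ioi 0) ∧
      BallsBins.lowerConst k = (k ! : ℝ) ^ (1 / (k : ℝ)) * Real.Gamma (1 + 1 / (k : ℝ))) ∧
    -- `c_k` is a lower bound, and no larger lower bound is possible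
    ((∀ (n : ℕ) (p : PMF (Fin n)),
        ENNReal.ofReal (BallsBins.lowerConst k) ≤
          BallsBins.kNorm k p * BallsBins.expectedWait k p) ∧
      (∀ (N : ℕ) (b : ℝ≥0∞),
        (∀ (n : ℕ) (p : PMF (Fin n)), N ≤ n → (∀ i, 0 < p i) →
          b ≤ BallsBins.kNorm k p * BallsBins.expectedWait k p) →
        b ≤ ENNReal.ofReal (BallsBins.lowerConst k))) ∧
    -- `k` is an upper bound, and no smaller upper bound is possible
    ((∀ (n : ℕ) (p : PMF (Fin n)),
        BallsBins.kNorm k p * BallsBins.expectedWait k p ≤ (k : ℝ≥0∞)) ∧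
      (∀ (N : ℕ) (b : ℝ≥0∞),
        (∀ (n : ℕ) (p : PMF (Fin n)), N ≤ n → (∀ i, 0 < p i) →
          BallsBins.kNorm k p * BallsBins.expectedWait k p ≤ b) →
        (k : ℝ≥0∞) ≤ b)) := by
  have hk0 : 0 < k := by omega
  refine ⟨⟨BallsBins.integrableOn_exp_neg_pow_div hk0, BallsBins.lowerConst_eq hk0⟩,
    ⟨fun n p => BallsBins.lowerConst_le p hk0, fun N b hb => ?_⟩,
    fun n p => BallsBins.kNorm_mul_expectedWait_le p hk0, fun N b hb => ?_⟩
  · refine ge_of_tendsto (BallsBins.tendsto_kNorm_mul_expectedWait_uniform hk0) ?_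
    filter_upwards [Filter.eventually_ge_atTop N] with m hm
    refine hb (m + 1) _ (by omega) fun i => ?_
    rw [PMF.uniformOfFintype_apply]
    exact ENNReal.inv_pos.2 (ENNReal.natCast_ne_top _)
  · have hlim : Filter.Tendsto (fun m : ℕ => (1 - ((m + 2 : ℕ) : ℝ≥0∞)⁻¹) * k) Filter.atTop
        (nhds ((1 - 0) * k)) :=
      ENNReal.Tendsto.mul_const (ENNReal.Tendsto.sub tendsto_const_nhds
        (ENNReal.tendsto_inv_nat_nhds_zero.comp (Filter.tendsto_add_atTop_nat 2))
        (Or.inl ENNReal.one_ne_top)) (Or.inr (ENNReal.natCast_ne_top k))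
    rw [tsub_zero, one_mul] at hlim
    refine le_of_tendsto' hlim fun m => ?_
    -- The shift by 2 makes d < 1 already at m = 0.
    obtain ⟨p, hp, hp0⟩ := BallsBins.exists_concentrated N (d := ((m + 2 : ℕ) : ℝ≥0∞)⁻¹)
      (ENNReal.inv_pos.2 (ENNReal.natCast_ne_top _))
      (ENNReal.inv_lt_one.2 (by exact_mod_cast (by omega : 1 < m + 2)))
    exact (mul_le_mul' (hp0.trans (BallsBins.le_kNorm hk0 p 0))
      (BallsBins.le_expectedWait k p)).trans (hb (N + 1) p (by omega) hp)
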